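/- Let $\phi$ be the standard normal density, $\overline\Phi(s)=\int_s^\infty\phi$, and let $\gamma$ be a positive, symmetric, unimodal probability density on $\mathbb{R}$ such that, for some $\Lambda$ and some $\kappa\in[1,2]$: $|\log\gamma(x)-\log\gamma(y)|\le\Lambda|x-y|$ for all $x,y\in\mathbb{R}$; $\gamma(y)^{-1}\int_y^\infty\gamma(u)\,du\asymp y^{\kappa-1}$ as $y\to\infty$ (i.e. the ratio of the two sides stays between two positive constants for $y$ large); and $y\mapsto y^2\gamma(y)$ is bounded. Put $g(x)=\int\gamma(x-u)\phi(u)\,du$, $\overline G(s)=\int_s^\infty g$, $\beta=g/\phi-1$, and for $w\in[0,1]$ $$\ell(x;w)=\frac{(1-w)\phi(x)}{(1-w)\phi(x)+w\,g(x)},\qquad q(x;w)=\frac{(1-w)\overline\Phi(|x|)}{(1-w)\overline\Phi(|x|)+w\,\overline G(|x|)}.$$ For $\theta_0\in\mathbb{R}^n$ one observes $X_i=\theta_{0,i}+\varepsilon_i$, $1\le i\le n$, with $\varepsilon_i$ i.i.d. $\mathcal N(0,1)$; $E_{\theta_0}$ is the corresponding expectation. Let $\hat w=\hat w(X)$ be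 the (almost surely unique) maximiser over $w\in[1/n,1]$ of the log-marginal likelihood $L(w)=\sum_{i=1}^n\log\phi(X_i)+\sum_{i=1}^n\log(1+w\beta(X_i))$ (the largest maximiser on the null event where it is not unique). For $t\in(0,1)$ define the empirical Bayes $\ell$-value and $q$-value multiple testing procedures by $$\varphi^{\ell}_i(X)=\mathbf 1\{\ell(X_i;\hat w)\le t\},\qquad \varphi^{q}_i(X)=\mathbf 1\{q(X_i;\hat w)\le t\},\qquad 1\le i\le n,$$ where the value $1$ means that the hypothesis $\theta_{0,i}=0$ is rejected. The false negative rate of a procedure $\varphi$ at $\theta_0$ is $$\mathrm{FNR}(\theta_0,\varphi)=E_{\theta_0}\left[\frac{\sum_{i=1}^n\mathbf 1\{\theta_{0,i}\ne0\}(1-\varphi_i(X))}{1\vee\sum_{i=1}^n\mathbf 1\{\theta_{0,i}\ne0\}}\right].$$ Let $a>1$, let $\upsilon\in(0,1)$, and let $(s_n)$ be a sequence of nonnegative integers with $s_n\to\infty$ and $s_n\le n^{\upsilon}$. Let $\mathcal L_0[s_n;a]$ be the set of all $\theta\in\mathbb{R}^n$ that have exactly $s_n$ nonzero coordinates, all of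 them satisfying $|\theta_i|\ge a\sqrt{2\log(n/s_n)}$. Then, for every fixed level $t\in(0,1)$, the procedures $\varphi^{\ell}$ and $\varphi^{q}$ are measurable functions of $X$, and $$\lim_{n\to\infty}\ \sup_{\theta_0\in\mathcal L_0[s_n;a]}\mathrm{FNR}(\theta_0,\varphi^{\ell})=\lim_{n\to\infty}\ \sup_{\theta_0\in\mathcal L_0[s_n;a]}\mathrm{FNR}(\theta_0,\varphi^{q})=0.$$ -/

import Mathlib

open MeasureTheory ProbabilityTheory Filter Topology

noncomputable section

namespace SpikeSlab

/-- A function on the line is unimodal if it is nondecreasing up to some point (a mode) and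
nonincreasing from that point on. -/
def IsUnimodal (γ : ℝ → ℝ) : Prop :=
  ∃ m : ℝ, MonotoneOn γ (Set.Iic m) ∧ AntitoneOn γ (Set.Ici m)

/-- The assumptions on the slab density `γ`: a positive, symmetric, unimodal probability density
whose logarithm is `Λ`-Lipschitz, with `γ(y)⁻¹ ∫_y^∞ γ ≍ y ^ (κ - 1)` as `y → ∞`, and with
`y² γ(y)` bounded. (Positivity is implicit in the use of `log γ`; `∫ γ = 1` forces integrability,
since the integral of a non-integrable function is `0` here.) -/
structure IsSlabDensity (γ : ℝ → ℝ) (Λ κ : ℝ) : Prop where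
  pos : ∀ x, 0 < γ x
  integral_eq_one : ∫ x, γ x = 1
  symm : ∀ x, γ (-x) = γ x
  unimodal : IsUnimodal γ
  log_lipschitz : ∀ x y, |Real.log (γ x) - Real.log (γ y)| ≤ Λ * |x - y|
  tail : (fun y : ℝ => (γ y)⁻¹ * ∫ u in Set.Ioi y, γ u) =Θ[atTop] fun y : ℝ => y ^ (κ - 1)
  bounded : ∃ C : ℝ, ∀ y, y ^ 2 * γ y ≤ C

/-- The standard normal density. -/
def phi (x : ℝ) : ℝ := gaussianPDFReal 0 1 x

/-- The upper tail function of the standard normal distribution. -/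
def PhiBar (s : ℝ) : ℝ := ∫ x in Set.Ioi s, phi x

/-- The convolution of the slab density with the standard normal density. -/
def g (γ : ℝ → ℝ) (x : ℝ) : ℝ := ∫ u, γ (x - u) * phi u

/-- The upper tail function of `g`. -/
def GBar (γ : ℝ → ℝ) (s : ℝ) : ℝ := ∫ x in Set.Ioi s, g γ x

/-- The `ℓ`-value function. -/
def lval (γ : ℝ → ℝ) (w x : ℝ) : ℝ :=
  (1 - w) * phi x / ((1 - w) * phi x + w * g γ x)

/-- The `q`-value function. -/
def qval (γ : ℝ → ℝ) (w x : ℝ) : ℝ :=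
  (1 - w) * PhiBar |x| / ((1 - w) * PhiBar |x| + w * GBar γ |x|)

/-- `β = g / φ - 1`. -/
def beta (γ : ℝ → ℝ) (x : ℝ) : ℝ := g γ x / phi x - 1

/-- The log-marginal likelihood of the weight `w` given the data `X`. -/
def logLik (γ : ℝ → ℝ) {n : ℕ} (X : Fin n → ℝ) (w : ℝ) : ℝ :=
  ∑ i, Real.log (phi (X i)) + ∑ i, Real.log (1 + w * beta γ (X i))

/-- The marginal maximum likelihood estimator of the weight: the maximiser of the log-marginal
likelihood over `[1/n, 1]`. The maximiser is almost surely unique; on the null event where it is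
not, the largest one is taken. -/
def wHat (γ : ℝ → ℝ) {n : ℕ} (X : Fin n → ℝ) : ℝ :=
  sSup {w | w ∈ Set.Icc (1 / (n : ℝ)) 1 ∧ IsMaxOn (logLik γ X) (Set.Icc (1 / (n : ℝ)) 1) w}

/-- The empirical Bayes `ℓ`-value procedure at level `t` (value `1` means rejection). -/
def phiL (γ : ℝ → ℝ) (t : ℝ) {n : ℕ} (X : Fin n → ℝ) (i : Fin n) : ℝ :=
  if lval γ (wHat γ X) (X i) ≤ t then 1 else 0

/-- The empirical Bayes `q`-value procedure at level `t` (value `1` means rejection). -/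
def phiQ (γ : ℝ → ℝ) (t : ℝ) {n : ℕ} (X : Fin n → ℝ) (i : Fin n) : ℝ :=
  if qval γ (wHat γ X) (X i) ≤ t then 1 else 0

/-- The law of the data `X i = θ i + ε i`, `ε i` i.i.d. standard normal. -/
def law {n : ℕ} (θ : Fin n → ℝ) : Measure (Fin n → ℝ) :=
  Measure.pi fun i => gaussianReal (θ i) 1

/-- The false negative rate of the procedure `φ` at `θ`. -/
def FNR {n : ℕ} (θ : Fin n → ℝ) (φ : (Fin n → ℝ) → Fin n → ℝ) : ℝ :=
  ∫ X, (∑ i, (if θ i ≠ 0 then 1 else 0) * (1 - φ X i)) /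
    max 1 (∑ i, (if θ i ≠ 0 then (1 : ℝ) else 0)) ∂(law θ)

/-- The support of a vector. -/
def support {n : ℕ} (θ : Fin n → ℝ) : Set (Fin n) := {i | θ i ≠ 0}

/-- The `s`-sparse vectors. -/
def ell0 (n s : ℕ) : Set (Fin n → ℝ) := {θ | (support θ).ncard ≤ s}

/-- The class of strong signals with exactly `s` nonzero coordinates, each at least
`a √(2 log (n / s))` in absolute value. -/
def strongClass (n s : ℕ) (a : ℝ) : Set (Fin n → ℝ) :=
  {θ | θ ∈ ell0 n s ∧
    (∀ i ∈ support θ, a * √(2 * Real.log ((n : ℝ) / (s : ℝ))) ≤ |θ i|) ∧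
    (support θ).ncard = s}

end SpikeSlab

end

/-! A Gaussian tail loses to an exponential one. As log γ is Lipschitz, g and its tail are at least
c·exp(-Λ|x|) (`exists_lower_bound`), while φ and its tail are at most exp(-x²/2). With R = log(n/s)
and 1 < b < a, for |x| ≥ T = b√(2R) the Gaussian bound is eventually below any fixed multiple of
(s/n)·exp(-Λ|x|) (`eventually_exponent_ge`).

Suppose at least half of the signals are observed beyond T. The score at w = s/(16n) is then
positive, so the maximiser is at least w by concavity of the log-likelihood
(`le_wHat_of_many_large`), and every ℓ- and q-value beyond T is at most t (`posterior_le`). Hence a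
signal is missed only if it is observed below T, or if more than half of them are. Chebyshev bounds
the probability that a given signal falls below T by O(1/R), and linearity of expectation bounds the
FNR by three times this (`FNR_le`); only the marginal laws matter. `tendsto_iSup_FNR` packages the
argument for both procedures. -/

namespace SpikeSlab

/-! ### Gaussian upper bounds for the normal density and its tail. -/

lemma phi_pos (x : ℝ) : 0 < phi x := gaussianPDFReal_pos 0 1 x one_ne_zero

lemma phi_eq (x : ℝ) : phi x = (√(2 * Real.pi))⁻¹ * Real.exp (-x ^ 2 / 2) := by
  simp [phi, gaussianPDFReal]

lemma continuous_phi : Continuous phi := by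
  have : phi = fun x => (√(2 * Real.pi))⁻¹ * Real.exp (-x ^ 2 / 2) := funext phi_eq
  rw [this]
  fun_prop

lemma integrable_phi : Integrable phi := integrable_gaussianPDFReal 0 1

lemma phi_le_exp (x : ℝ) : phi x ≤ Real.exp (-x ^ 2 / 2) := by
  rw [phi_eq]
  apply mul_le_of_le_one_left (Real.exp_pos _).le
  apply inv_le_one_of_one_le₀
  rw [Real.one_le_sqrt]
  linarith [Real.pi_gt_three]

lemma PhiBar_nonneg (s : ℝ) : 0 ≤ PhiBar s :=
  setIntegral_nonneg measurableSet_Ioi fun x _ => (phi_pos x).le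

lemma PhiBar_eq (s : ℝ) : PhiBar s = (gaussianReal 0 1).real (Set.Ioi s) := by
  rw [measureReal_def, gaussianReal_apply_eq_integral 0 one_ne_zero]
  exact (ENNReal.toReal_ofReal (PhiBar_nonneg s)).symm

lemma PhiBar_le_exp {s : ℝ} (hs : 0 ≤ s) : PhiBar s ≤ Real.exp (-s ^ 2 / 2) := by
  rw [PhiBar_eq]
  -- Chernoff bound with the optimal exponent, equal to the level `s` itself.
  have h := measure_ge_le_exp_mul_mgf (μ := gaussianReal 0 1) (X := id) s hs
    (by simpa using integrable_exp_mul_gaussianReal (μ := 0) (v := 1) s)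
  rw [mgf_id_gaussianReal, ← Real.exp_add] at h
  refine (measureReal_mono (Set.Ioi_subset_Ici_self (a := s)) (measure_ne_top _ _)).trans (h.trans (le_of_eq ?_))
  congr 1
  push_cast
  ring

lemma antitone_setIntegral_Ioi {f : ℝ → ℝ} (hf : Integrable f) (h0 : ∀ x, 0 ≤ f x) :
    Antitone fun s => ∫ x in Set.Ioi s, f x := fun _ _ h =>
  setIntegral_mono_set hf.integrableOn (ae_of_all _ h0) (Set.Ioi_subset_Ioi h).eventuallyLE

lemma measurable_PhiBar : Measurable PhiBar :=
  (antitone_setIntegral_Ioi integrable_phi fun x => (phi_pos x).le).measurable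

lemma g_eq_convolution (γ : ℝ → ℝ) :
    g γ = convolution phi γ (ContinuousLinearMap.mul ℝ ℝ) volume := by
  funext x
  simp [g, convolution, mul_comm]

/-! ### Exponential lower bounds for `g` and its tail. -/

namespace IsSlabDensity

variable {γ : ℝ → ℝ} {Λ κ : ℝ} (hγ : IsSlabDensity γ Λ κ)
include hγ

lemma lipschitz_nonneg : 0 ≤ Λ := by
  have h := (abs_nonneg _).trans (hγ.log_lipschitz 1 0)
  simpa using h

lemma le_exp_mul (x y : ℝ) : γ x ≤ Real.exp (Λ * |x - y|) * γ y := by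
  have h := (le_abs_self _).trans (hγ.log_lipschitz x y)
  calc γ x = Real.exp (Real.log (γ x)) := (Real.exp_log (hγ.pos x)).symm
    _ ≤ Real.exp (Λ * |x - y| + Real.log (γ y)) := Real.exp_le_exp.2 (by linarith)
    _ = Real.exp (Λ * |x - y|) * γ y := by rw [Real.exp_add, Real.exp_log (hγ.pos y)]

lemma continuous : Continuous γ := by
  have h : Continuous fun x => Real.log (γ x) :=
    (LipschitzWith.of_dist_le_mul (K := ⟨Λ, hγ.lipschitz_nonneg⟩) hγ.log_lipschitz).continuous
  have h2 : γ = fun x => Real.exp (Real.log (γ x)) := by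
    funext x
    rw [Real.exp_log (hγ.pos x)]
  rw [h2]
  exact Real.continuous_exp.comp h

lemma integrable : Integrable γ := by
  by_contra h
  have := hγ.integral_eq_one
  rw [integral_undef h] at this
  exact zero_ne_one this

lemma exists_bound : ∃ B, ∀ x, γ x ≤ B := by
  obtain ⟨C, hC⟩ := hγ.bounded
  refine ⟨max C (Real.exp Λ * γ 0), fun x => ?_⟩
  rcases le_total 1 |x| with h | h
  · refine le_max_of_le_left (le_trans ?_ (hC x))
    refine le_mul_of_one_le_left (hγ.pos x).le ?_
    rw [← sq_abs]
    exact one_le_pow₀ h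
  · refine le_max_of_le_right ((hγ.le_exp_mul x 0).trans ?_)
    refine mul_le_mul_of_nonneg_right (Real.exp_le_exp.2 ?_) (hγ.pos 0).le
    rw [sub_zero]
    exact mul_le_of_le_one_right hγ.lipschitz_nonneg h

lemma integrable_mul_phi (x : ℝ) : Integrable fun u => γ (x - u) * phi u := by
  obtain ⟨B, hB⟩ := hγ.exists_bound
  refine integrable_phi.bdd_mul (c := B) ?_ (ae_of_all _ fun u => ?_)
  · exact (hγ.continuous.comp (continuous_const.sub continuous_id)).aestronglyMeasurable
  · rw [Real.norm_of_nonneg (hγ.pos _).le]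
    exact hB _

lemma integrable_g : Integrable (g γ) := by
  rw [g_eq_convolution]
  exact integrable_phi.integrable_convolution _ hγ.integrable

lemma continuous_g : Continuous (g γ) := by
  obtain ⟨B, hB⟩ := hγ.exists_bound
  rw [g_eq_convolution]
  refine BddAbove.continuous_convolution_right_of_integrable _ ⟨B, ?_⟩ integrable_phi hγ.continuous
  rintro _ ⟨x, rfl⟩
  simpa [abs_of_pos (hγ.pos x)] using hB x

lemma g_pos (x : ℝ) : 0 < g γ x := by
  refine integral_pos_of_integrable_nonneg_nonzero (x := 0)
    ((hγ.continuous.comp (continuous_const.sub continuous_id)).mul continuous_phi)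
    (hγ.integrable_mul_phi x) (fun u => (mul_pos (hγ.pos _) (phi_pos u)).le) ?_
  exact (mul_pos (hγ.pos _) (phi_pos _)).ne'

/-- Convolution preserves the log-Lipschitz bound, since it compares `γ` at two points a fixed
distance apart, uniformly in `u`. -/
lemma g_ge (x : ℝ) : g γ 0 * Real.exp (-(Λ * |x|)) ≤ g γ x := by
  have h : g γ 0 ≤ Real.exp (Λ * |x|) * g γ x := by
    unfold g
    rw [← integral_const_mul]
    refine integral_mono (hγ.integrable_mul_phi 0) ((hγ.integrable_mul_phi x).const_mul _)
      fun u => ?_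
    have h1 := hγ.le_exp_mul (0 - u) (x - u)
    have h2 : |0 - u - (x - u)| = |x| := by
      rw [← abs_neg]
      congr 1
      ring
    rw [h2] at h1
    calc γ (0 - u) * phi u ≤ (Real.exp (Λ * |x|) * γ (x - u)) * phi u :=
          mul_le_mul_of_nonneg_right h1 (phi_pos u).le
      _ = Real.exp (Λ * |x|) * (γ (x - u) * phi u) := by ring
  rw [Real.exp_neg, ← div_eq_mul_inv, div_le_iff₀ (Real.exp_pos _)]
  linarith

lemma GBar_ge {s : ℝ} (hs : 0 ≤ s) :
    g γ 0 * Real.exp (-Λ) * Real.exp (-(Λ * s)) ≤ GBar γ s := by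
  -- One unit interval of the tail suffices; its length costs the factor `exp (-Λ)`.
  have h1 : ∫ _ in Set.Ioc s (s + 1), g γ 0 * Real.exp (-Λ) * Real.exp (-(Λ * s))
      ≤ ∫ x in Set.Ioc s (s + 1), g γ x := by
    refine setIntegral_mono_on (integrableOn_const (by simp)) hγ.integrable_g.integrableOn
      measurableSet_Ioc fun x hx => le_trans ?_ (hγ.g_ge x)
    rw [mul_assoc, ← Real.exp_add]
    refine mul_le_mul_of_nonneg_left (Real.exp_le_exp.2 ?_) (hγ.g_pos 0).le
    rw [abs_of_nonneg (hs.trans hx.1.le)]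
    nlinarith [hγ.lipschitz_nonneg, hx.2]
  have h2 : ∫ x in Set.Ioc s (s + 1), g γ x ≤ GBar γ s :=
    setIntegral_mono_set hγ.integrable_g.integrableOn (ae_of_all _ fun x => (hγ.g_pos x).le)
      Set.Ioc_subset_Ioi_self.eventuallyLE
  refine le_trans (le_of_eq ?_) (h1.trans h2)
  simp

lemma measurable_GBar : Measurable (GBar γ) :=
  (antitone_setIntegral_Ioi hγ.integrable_g fun x => (hγ.g_pos x).le).measurable

lemma exists_lower_bound : ∃ c, 0 < c ∧ (∀ x, c * Real.exp (-(Λ * |x|)) ≤ g γ x) ∧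
    ∀ x, c * Real.exp (-(Λ * |x|)) ≤ GBar γ |x| := by
  refine ⟨g γ 0 * Real.exp (-Λ), mul_pos (hγ.g_pos 0) (Real.exp_pos _), fun x => ?_,
    fun x => hγ.GBar_ge (abs_nonneg x)⟩
  refine le_trans (mul_le_mul_of_nonneg_right ?_ (Real.exp_pos _).le) (hγ.g_ge x)
  exact mul_le_of_le_one_right (hγ.g_pos 0).le
    (Real.exp_le_one_iff.2 (neg_nonpos.2 hγ.lipschitz_nonneg))

end IsSlabDensity
-- The maximum likelihood weight: existence, measurability, lower bound.
lemma one_div_natCast_le_one (n : ℕ) : 1 / (n : ℝ) ≤ 1 := by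
  rcases n.eq_zero_or_pos with rfl | h
  · simp
  · exact div_le_one_of_le₀ (by exact_mod_cast h) (by positivity)

namespace IsSlabDensity

variable {γ : ℝ → ℝ} {Λ κ : ℝ} (hγ : IsSlabDensity γ Λ κ)
include hγ

lemma one_add_beta_pos (x : ℝ) : 0 < 1 + beta γ x := by
  have := div_pos (hγ.g_pos x) (phi_pos x)
  unfold beta
  linarith

lemma one_add_mul_beta_pos (x : ℝ) {w : ℝ} (h0 : 0 ≤ w) (h1 : w ≤ 1) :
    0 < 1 + w * beta γ x := by
  have := hγ.one_add_beta_pos x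
  rcases h1.lt_or_eq with h | rfl
  · nlinarith
  · linarith

lemma continuous_beta : Continuous (beta γ) :=
  (hγ.continuous_g.div continuous_phi fun x => (phi_pos x).ne').sub continuous_const

lemma continuous_logLik (n : ℕ) : Continuous fun p : Set.Icc (1 / (n : ℝ)) 1 × (Fin n → ℝ) =>
    logLik γ p.2 p.1 := by
  unfold logLik
  have hφ := continuous_phi
  have hβ := hγ.continuous_beta
  refine Continuous.add (continuous_finsetSum _ fun i _ => ?_)
    (continuous_finsetSum _ fun i _ => ?_)
  · exact Continuous.log (by fun_prop) fun p => (phi_pos _).ne'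
  · exact Continuous.log (by fun_prop) fun p =>
      (hγ.one_add_mul_beta_pos _ (le_trans (by positivity) p.1.2.1) p.1.2.2).ne'

lemma isClosed_isMaxOn (n : ℕ) : IsClosed {p : Set.Icc (1 / (n : ℝ)) 1 × (Fin n → ℝ) |
    ∀ v : Set.Icc (1 / (n : ℝ)) 1, logLik γ p.2 v ≤ logLik γ p.2 p.1} := by
  have h := hγ.continuous_logLik n
  simp only [Set.ofPred_forall]
  exact isClosed_iInter fun v => isClosed_le
    (h.comp (continuous_const.prodMk continuous_snd)) h

/-- The set of maximisers of the marginal likelihood contains its supremum. -/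
lemma wHat_mem {n : ℕ} (X : Fin n → ℝ) : wHat γ X ∈
    {w | w ∈ Set.Icc (1 / (n : ℝ)) 1 ∧ IsMaxOn (logLik γ X) (Set.Icc (1 / (n : ℝ)) 1) w} := by
  have hset : {w | w ∈ Set.Icc (1 / (n : ℝ)) 1 ∧
      IsMaxOn (logLik γ X) (Set.Icc (1 / (n : ℝ)) 1) w} = Subtype.val ''
      {w : Set.Icc (1 / (n : ℝ)) 1 |
        ∀ v : Set.Icc (1 / (n : ℝ)) 1, logLik γ X v ≤ logLik γ X w} := by
    ext w
    simp [isMaxOn_iff]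
    tauto
  have hL : Continuous fun w : Set.Icc (1 / (n : ℝ)) 1 => logLik γ X w :=
    Continuous.comp (g := fun p : Set.Icc (1 / (n : ℝ)) 1 × (Fin n → ℝ) => logLik γ p.2 p.1)
      (f := fun w => (w, X)) (hγ.continuous_logLik n) (by fun_prop)
  unfold wHat
  rw [hset]
  refine IsCompact.sSup_mem (IsCompact.image ?_ continuous_subtype_val) ?_
  · refine IsClosed.isCompact ?_
    simp only [Set.ofPred_forall]
    exact isClosed_iInter fun v => isClosed_le continuous_const hL
  · have : Nonempty (Set.Icc (1 / (n : ℝ)) 1) := ⟨1, one_div_natCast_le_one n, le_rfl⟩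
    obtain ⟨w, -, hw⟩ := isCompact_univ.exists_isMaxOn Set.univ_nonempty hL.continuousOn
    exact Set.Nonempty.image _ ⟨w, fun v => hw (Set.mem_univ v)⟩

/-- Taking the largest maximiser makes `wHat` upper semicontinuous: its superlevel sets are
projections of closed sets along a compact interval, hence closed. -/
lemma measurable_wHat (n : ℕ) : Measurable (wHat γ : (Fin n → ℝ) → ℝ) := by
  refine measurable_of_Ici fun c => IsClosed.measurableSet ?_
  have hset : (wHat γ : (Fin n → ℝ) → ℝ) ⁻¹' Set.Ici c = Prod.snd ''
      ({p : Set.Icc (1 / (n : ℝ)) 1 × (Fin n → ℝ) |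
        ∀ v : Set.Icc (1 / (n : ℝ)) 1, logLik γ p.2 v ≤ logLik γ p.2 p.1} ∩
        {p | c ≤ p.1}) := by
    ext X
    constructor
    · intro h
      exact ⟨(⟨wHat γ X, (hγ.wHat_mem X).1⟩, X),
        ⟨fun v => (hγ.wHat_mem X).2 v.2, h⟩, rfl⟩
    · rintro ⟨⟨w, Y⟩, ⟨h1, h2⟩, rfl⟩
      have h3 : (w : ℝ) ≤ wHat γ Y := by
        unfold wHat
        exact le_csSup ⟨1, fun v hv => hv.1.2⟩ ⟨w.2, fun v hv => h1 ⟨v, hv⟩⟩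
      exact le_trans (show c ≤ (w : ℝ) from h2) h3
  rw [hset]
  exact isClosedMap_snd_of_compactSpace _ ((hγ.isClosed_isMaxOn n).inter
    (isClosed_le continuous_const (continuous_subtype_val.comp continuous_fst)))

lemma measurable_phiL (t : ℝ) (n : ℕ) : Measurable (phiL γ t : (Fin n → ℝ) → Fin n → ℝ) := by
  have hφ := continuous_phi.measurable
  have hg := hγ.continuous_g.measurable
  have hw := hγ.measurable_wHat n
  refine measurable_pi_lambda _ fun i => Measurable.ite (measurableSet_le ?_ measurable_const)
    measurable_const measurable_const
  unfold lval
  fun_prop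

lemma measurable_phiQ (t : ℝ) (n : ℕ) : Measurable (phiQ γ t : (Fin n → ℝ) → Fin n → ℝ) := by
  have hφ := measurable_PhiBar
  have hg := hγ.measurable_GBar
  have hw := hγ.measurable_wHat n
  have habs : Measurable fun x : ℝ => |x| := continuous_abs.measurable
  refine measurable_pi_lambda _ fun i => Measurable.ite (measurableSet_le ?_ measurable_const)
    measurable_const measurable_const
  unfold qval
  fun_prop

/-- A positive score at `w` pushes the maximum likelihood estimator above `w`. -/
lemma le_wHat_of_score_pos {n : ℕ} (X : Fin n → ℝ) {w : ℝ} (hw : w ∈ Set.Icc (1 / (n : ℝ)) 1)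
    (hscore : 0 < ∑ i, beta γ (X i) / (1 + w * beta γ (X i))) : w ≤ wHat γ X := by
  by_contra! hlt
  obtain ⟨hv, hmax⟩ := hγ.wHat_mem X
  set v := wHat γ X
  have hv0 : 0 ≤ v := le_trans (by positivity) hv.1
  -- Concavity in the weight, termwise from `1 - 1 / x ≤ log x` at the ratio of the two factors.
  have h1 : (w - v) * ∑ i, beta γ (X i) / (1 + w * beta γ (X i)) ≤
      logLik γ X w - logLik γ X v := by
    unfold logLik
    rw [add_sub_add_left_eq_sub, ← Finset.sum_sub_distrib, Finset.mul_sum]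
    refine Finset.sum_le_sum fun i _ => ?_
    have hW := hγ.one_add_mul_beta_pos (X i) (hv0.trans hlt.le) hw.2
    have hV := hγ.one_add_mul_beta_pos (X i) hv0 hv.2
    rw [← Real.log_div hW.ne' hV.ne']
    refine le_trans (le_of_eq ?_) (Real.one_sub_inv_le_log_of_pos (div_pos hW hV))
    field_simp
    ring
  have h2 : logLik γ X w ≤ logLik γ X v := hmax hw
  nlinarith [mul_pos (sub_pos.2 hlt) hscore]

/-- If at least half of `s` coordinates carry large signals, the estimated weight is at least
`s / (16 n)`. -/
lemma le_wHat_of_many_large {n : ℕ} (X : Fin n → ℝ) {s : ℝ} (hs : 16 ≤ s) (hsn : s ≤ n)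
    (A : Finset (Fin n)) (hA : ∀ i ∈ A, 1 ≤ s / (16 * n) * beta γ (X i))
    (hcard : s / 2 ≤ A.card) : s / (16 * n) ≤ wHat γ X := by
  have hn : (0 : ℝ) < n := by linarith
  have hw0 : 0 < s / (16 * n) := by positivity
  have hw1 : s / (16 * n) ≤ 1 / 2 := by
    rw [div_le_div_iff₀ (by positivity) (by norm_num)]
    linarith
  have hwinv : (s / (16 * n))⁻¹ = 16 * n / s := inv_div _ _
  set w := s / (16 * (n : ℝ)) with hw
  refine hγ.le_wHat_of_score_pos X ⟨?_, by linarith⟩ ?_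
  · rw [hw, div_le_div_iff₀ hn (by positivity)]
    nlinarith
  -- As `β > -1` and `w ≤ 1/2`, every term is at least `-2`; where `w * β ≥ 1` it is at least `1 /
  -- (2 * w)`. Summing gives at least `4 * n - 2 * n > 0`.
  have hterm : ∀ i, (if i ∈ A then w⁻¹ / 2 else 0) - 2 ≤
      beta γ (X i) / (1 + w * beta γ (X i)) := by
    intro i
    have hpos := hγ.one_add_mul_beta_pos (X i) hw0.le (by linarith)
    have hb := hγ.one_add_beta_pos (X i)
    rw [le_div_iff₀ hpos]
    split_ifs with h
    · have h1 := hA i h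
      have h2 : w⁻¹ / 2 * (1 + w * beta γ (X i)) = w⁻¹ / 2 + beta γ (X i) / 2 := by
        field_simp
      have h3 : w⁻¹ ≤ beta γ (X i) := by
        rwa [inv_le_iff_one_le_mul₀' hw0]
      rw [sub_mul, h2]
      linarith
    · nlinarith
  refine lt_of_lt_of_le ?_ (Finset.sum_le_sum fun i _ => hterm i)
  rw [Finset.sum_sub_distrib, Finset.sum_ite_mem, Finset.univ_inter, Finset.sum_const,
    Finset.sum_const, Finset.card_univ, Fintype.card_fin, nsmul_eq_mul, nsmul_eq_mul, hwinv]
  have h4 : s / 2 * (16 * n / s / 2) ≤ A.card * (16 * n / s / 2) :=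
    mul_le_mul_of_nonneg_right hcard (by positivity)
  have h5 : s / 2 * (16 * n / s / 2) = 4 * n := by
    field_simp
    norm_num
  linarith

end IsSlabDensity
-- From small posterior values to the false negative rate.
lemma posterior_le {w p d t : ℝ} {w₁ : ℝ} (hw₁ : 0 < w₁) (hw : w₁ ≤ w) (hw1 : w ≤ 1)
    (hp : 0 ≤ p) (hd : 0 < d) (ht : 0 ≤ t) (h : p ≤ t * w₁ * d) :
    (1 - w) * p / ((1 - w) * p + w * d) ≤ t := by
  have hw0 : 0 < w := hw₁.trans_le hw
  have h1 : 0 ≤ (1 - w) * p := mul_nonneg (by linarith) hp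
  have h2 : t * w₁ * d ≤ t * w * d := by gcongr
  rw [div_le_iff₀ (by positivity)]
  -- It is enough that `(1 - w) * p ≤ p ≤ t * w * d`.
  nlinarith [mul_nonneg ht h1, mul_nonneg hw0.le hp]

lemma support_ncard {n : ℕ} (θ : Fin n → ℝ) :
    (support θ).ncard = (Finset.univ.filter fun i => θ i ≠ 0).card := by
  rw [← Set.ncard_coe_finset]
  simp [support]

lemma sum_indicator_support {n : ℕ} (θ : Fin n → ℝ) :
    ∑ i, (if θ i ≠ 0 then (1 : ℝ) else 0) = (support θ).ncard := by
  rw [support_ncard, Finset.sum_boole]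

/-- Chebyshev's inequality for a shifted normal variable. -/
lemma gaussianReal_abs_lt_le {m T r : ℝ} (hr : 0 < r) (h : T + r ≤ |m|) :
    (gaussianReal m 1).real {x | |x| < T} ≤ 1 / r ^ 2 := by
  have hc := meas_ge_le_variance_div_sq (μ := gaussianReal m 1) (X := id)
    (memLp_id_gaussianReal 2) hr
  rw [variance_id_gaussianReal] at hc
  simp only [id_eq, integral_id_gaussianReal, NNReal.coe_one] at hc
  refine ENNReal.toReal_le_of_le_ofReal (by positivity) ((measure_mono fun x hx => ?_).trans hc)
  simp only [Set.mem_ofPred_eq] at hx ⊢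
  have := abs_sub_abs_le_abs_sub m x
  rw [abs_sub_comm]
  linarith

/-- If a procedure with values in `[0, 1]` misses a signal only when its observation is below `T`,
except possibly when at least half of the signals are, its false negative rate is controlled by
the probability that a single signal is observed below `T`. -/
lemma FNR_le {n s : ℕ} (hs : 0 < s) (θ : Fin n → ℝ) (hθ : (support θ).ncard = s)
    (ψ : (Fin n → ℝ) → Fin n → ℝ) (h0 : ∀ X i, 0 ≤ ψ X i) (h1 : ∀ X i, ψ X i ≤ 1)
    {T p : ℝ} (hp : ∀ i, θ i ≠ 0 → (gaussianReal (θ i) 1).real {x | |x| < T} ≤ p)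
    (hψ : ∀ X, ((s : ℝ) / 2 ≤ (Finset.univ.filter fun i => θ i ≠ 0 ∧ T ≤ |X i|).card) →
      ∀ i, T ≤ |X i| → ψ X i = 1) :
    FNR θ ψ ≤ 3 * p := by
  have hs' : (0 : ℝ) < s := by exact_mod_cast hs
  have hs1 : (1 : ℝ) ≤ s := by exact_mod_cast hs
  set S := Finset.univ.filter fun i => θ i ≠ 0 with hS
  have hScard : S.card = s := by rw [← hθ, support_ncard]
  have hmax : max 1 (∑ i, (if θ i ≠ 0 then (1 : ℝ) else 0)) = s := by
    rw [sum_indicator_support, hθ, max_eq_right hs1]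
  have hnum : ∀ X, ∑ i, (if θ i ≠ 0 then (1 : ℝ) else 0) * (1 - ψ X i) = ∑ i ∈ S, (1 - ψ X i) := by
    intro X
    rw [hS, Finset.sum_filter]
    exact Finset.sum_congr rfl fun i _ => by split_ifs <;> simp
  have hprob : IsProbabilityMeasure (law θ) := by unfold law; infer_instance
  let B : Fin n → Set (Fin n → ℝ) := fun i => Function.eval i ⁻¹' {x | |x| < T}
  have hmeas : MeasurableSet {x : ℝ | |x| < T} := measurableSet_lt (by fun_prop) (by fun_prop)
  have hB : ∀ i, MeasurableSet (B i) := fun i => (measurable_pi_apply i) hmeas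
  have hBp : ∀ i, (law θ).real (B i) = (gaussianReal (θ i) 1).real {x | |x| < T} := fun i =>
    (measurePreserving_eval (fun i => gaussianReal (θ i) 1) i).measureReal_preimage
      hmeas.nullMeasurableSet
  have hBint : ∀ i, Integrable ((B i).indicator fun _ => (1 : ℝ)) (law θ) := fun i =>
    (integrable_const 1).indicator (hB i)
  have hsum0 : ∀ X, 0 ≤ ∑ i ∈ S, (B i).indicator (fun _ => (1 : ℝ)) X := fun X =>
    Finset.sum_nonneg fun i _ => Set.indicator_nonneg (fun _ _ => zero_le_one) X
  -- If fewer than half of the signals exceed `T`, the crude bound `s` is below twice the number of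
  -- small ones; otherwise the missed signals are among the small ones. The factor 3 covers both
  -- cases.
  have hpt : ∀ X, (∑ i ∈ S, (1 - ψ X i)) / s ≤
      3 / s * ∑ i ∈ S, (B i).indicator (fun _ => (1 : ℝ)) X := by
    intro X
    rw [div_mul_eq_mul_div]
    refine div_le_div_of_nonneg_right ?_ hs'.le
    by_cases hX : (s : ℝ) / 2 ≤ (Finset.univ.filter fun i => θ i ≠ 0 ∧ T ≤ |X i|).card
    · have h3 : ∑ i ∈ S, (1 - ψ X i) ≤ ∑ i ∈ S, (B i).indicator (fun _ => (1 : ℝ)) X := by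
        refine Finset.sum_le_sum fun i _ => ?_
        by_cases hi : |X i| < T
        · rw [Set.indicator_of_mem (show X ∈ B i from hi)]
          linarith [h0 X i]
        · rw [hψ X hX i (not_lt.1 hi), sub_self]
          exact Set.indicator_nonneg (fun _ _ => zero_le_one) X
      linarith [hsum0 X]
    · have h4 : ∑ i ∈ S, (1 - ψ X i) ≤ s := by
        rw [← hScard, ← nsmul_one, ← Finset.sum_const]
        exact Finset.sum_le_sum fun i _ => by linarith [h0 X i]
      have h5 : ∑ i ∈ S, (B i).indicator (fun _ => (1 : ℝ)) X =
          s - (Finset.univ.filter fun i => θ i ≠ 0 ∧ T ≤ |X i|).card := by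
        have h6 : ∀ i, (B i).indicator (fun _ => (1 : ℝ)) X =
            1 - if T ≤ |X i| then 1 else 0 := by
          intro i
          by_cases hi : |X i| < T
          · rw [Set.indicator_of_mem (show X ∈ B i from hi), if_neg (not_le.2 hi), sub_zero]
          · rw [Set.indicator_of_notMem (show X ∉ B i from hi), if_pos (not_lt.1 hi), sub_self]
        simp only [h6]
        rw [Finset.sum_sub_distrib, Finset.sum_const, nsmul_one, hScard, Finset.sum_boole, hS,
          Finset.filter_filter]
      linarith
  calc FNR θ ψ = ∫ X, (∑ i ∈ S, (1 - ψ X i)) / s ∂(law θ) := by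
        unfold FNR
        simp only [hmax, hnum]
    _ ≤ ∫ X, 3 / s * ∑ i ∈ S, (B i).indicator (fun _ => (1 : ℝ)) X ∂(law θ) := by
        -- Only the dominating function must be integrable, so `ψ` need not be measurable.
        refine integral_mono_of_nonneg (ae_of_all _ fun X => ?_)
          ((integrable_finsetSum _ fun i _ => hBint i).const_mul _) (ae_of_all _ hpt)
        exact div_nonneg (Finset.sum_nonneg fun i _ => by linarith [h1 X i]) hs'.le
    _ = 3 / s * ∑ i ∈ S, (law θ).real (B i) := by
        rw [integral_const_mul, integral_finsetSum _ fun i _ => hBint i]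
        simp only [integral_indicator_const _ (hB _), smul_eq_mul, mul_one]
    _ ≤ 3 / s * ∑ i ∈ S, p := by
        gcongr with i hi
        rw [hBp]
        exact hp i (Finset.mem_filter.1 hi).2
    _ = 3 * p := by
        rw [Finset.sum_const, hScard, nsmul_eq_mul]
        field_simp

lemma FNR_nonneg {n : ℕ} (θ : Fin n → ℝ) (ψ : (Fin n → ℝ) → Fin n → ℝ)
    (h1 : ∀ X i, ψ X i ≤ 1) : 0 ≤ FNR θ ψ := by
  refine integral_nonneg fun X => div_nonneg (Finset.sum_nonneg fun i _ => mul_nonneg ?_ ?_) ?_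
  · split_ifs <;> simp
  · linarith [h1 X i]
  · positivity

/-! ### Asymptotics in `n / s` and the uniform limit. -/

/-- Above the level `b √(2 R)` with `b > 1`, the exponent `x² / 2 - Λ |x|` eventually dominates
`R + K`. -/
lemma eventually_exponent_ge {b : ℝ} (hb : 1 < b) (Λ K : ℝ) : ∀ᶠ R : ℝ in atTop,
    ∀ x : ℝ, b * √(2 * R) ≤ |x| → R + K ≤ x ^ 2 / 2 - Λ * |x| := by
  have hb2 : 1 < b ^ 2 := by nlinarith
  -- Split `x² / 2 = x² / (2 b²) + η x²`: the first part is at least `R`, the second absorbs `Λ |x|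
  -- + K`.
  set η := (1 - (b ^ 2)⁻¹) / 2 with hη
  have hη0 : 0 < η := by
    have := inv_lt_one_of_one_lt₀ hb2
    linarith
  have hT : Tendsto (fun R : ℝ => b * √(2 * R)) atTop atTop :=
    (Real.tendsto_sqrt_atTop.comp (tendsto_id.const_mul_atTop two_pos)).const_mul_atTop
      (by linarith)
  filter_upwards [hT.eventually_ge_atTop 1, hT.eventually_ge_atTop ((Λ + |K|) / η),
    eventually_ge_atTop 0] with R h1 h2 hR x hx
  have hx1 : 1 ≤ |x| := h1.trans hx
  have hx2 : Λ + |K| ≤ η * |x| := by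
    have := (div_le_iff₀ hη0).1 (h2.trans hx)
    linarith
  have hx3 : b ^ 2 * (2 * R) ≤ x ^ 2 := by
    have h : (b * √(2 * R)) ^ 2 ≤ |x| ^ 2 := by gcongr
    rwa [mul_pow, Real.sq_sqrt (by linarith), sq_abs] at h
  have hx4 : 2 * R ≤ x ^ 2 * (b ^ 2)⁻¹ := by
    rw [← div_eq_mul_inv, le_div_iff₀ (by linarith)]
    linarith
  have hx5 : |x| ^ 2 = x ^ 2 := sq_abs x
  have hx6 : η * |x| ^ 2 = x ^ 2 / 2 - x ^ 2 * (b ^ 2)⁻¹ / 2 := by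
    rw [hx5, hη]
    ring
  nlinarith [mul_le_mul_of_nonneg_right hx2 (by linarith : 0 ≤ |x|), le_abs_self K, abs_nonneg K]

lemma tendsto_ratio {υ : ℝ} (hυ : υ < 1) {s : ℕ → ℕ} (hs : Tendsto s atTop atTop)
    (hsn : ∀ n : ℕ, (s n : ℝ) ≤ (n : ℝ) ^ υ) :
    Tendsto (fun n : ℕ => (n : ℝ) / (s n : ℝ)) atTop atTop := by
  refine tendsto_atTop_mono' _ ?_
    ((tendsto_rpow_atTop (sub_pos.2 hυ)).comp tendsto_natCast_atTop_atTop)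
  filter_upwards [eventually_gt_atTop 0, hs.eventually_gt_atTop 0] with n hn hsn0
  have hn' : (0 : ℝ) < n := by exact_mod_cast hn
  have hs' : (0 : ℝ) < s n := by exact_mod_cast hsn0
  rw [Function.comp_apply, le_div_iff₀ hs', Real.rpow_sub hn', Real.rpow_one, div_mul_eq_mul_div,
    div_le_iff₀ (by positivity)]
  exact mul_le_mul_of_nonneg_left (hsn n) hn'.le

/-- A procedure that rejects whenever the estimated weight is at least `s / (16 n)` and the
observation is in a range where the normal tail is dominated has vanishing false negative rate
over the class of strong signals. -/
theorem tendsto_iSup_FNR {γ : ℝ → ℝ} {Λ κ : ℝ} (hγ : IsSlabDensity γ Λ κ)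
    {a : ℝ} (ha : 1 < a) {υ : ℝ} (hυ : υ < 1)
    {s : ℕ → ℕ} (hs : Tendsto s atTop atTop) (hsn : ∀ n : ℕ, (s n : ℝ) ≤ (n : ℝ) ^ υ)
    {c : ℝ} (hc : 0 < c) (ψ : ∀ n : ℕ, (Fin n → ℝ) → Fin n → ℝ)
    (h0 : ∀ n X i, 0 ≤ ψ n X i) (h1 : ∀ n X i, ψ n X i ≤ 1)
    (hψ : ∀ n X i, ∀ w, 0 < w → w ≤ wHat γ X →
      Real.exp (-(X i) ^ 2 / 2) ≤ c * w * Real.exp (-(Λ * |X i|)) → ψ n X i = 1) :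
    Tendsto (fun n : ℕ => ⨆ θ : strongClass n (s n) a, FNR (θ : Fin n → ℝ) (ψ n))
      atTop (𝓝 0) := by
  obtain ⟨c₀, hc₀, hg, -⟩ := hγ.exists_lower_bound
  -- `c` serves the rejection condition; `c₀ / 2` gives `w * g / φ ≥ 2`, hence `w * β ≥ 1` because
  -- `w ≤ 1/2`.
  set c₁ := min c (c₀ / 2) with hc₁
  have hc₁0 : 0 < c₁ := lt_min hc (by positivity)
  have hR : Tendsto (fun n : ℕ => Real.log ((n : ℝ) / (s n : ℝ))) atTop atTop :=
    Real.tendsto_log_atTop.comp (tendsto_ratio hυ hs hsn)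
  -- Any `b` strictly between 1 and `a` works: `b > 1` gives domination, and the gap `(a - b) √(2R)`
  -- feeds Chebyshev.
  set b := (1 + a) / 2 with hb
  have hb1 : 1 < b := by linarith
  have hab : 0 < a - b := by linarith
  have hlim : Tendsto (fun n : ℕ =>
      3 * (1 / ((a - b) * √(2 * Real.log ((n : ℝ) / (s n : ℝ)))) ^ 2)) atTop (𝓝 0) := by
    have hsq : Tendsto (fun n : ℕ => (a - b) * √(2 * Real.log ((n : ℝ) / (s n : ℝ))))
        atTop atTop := (Real.tendsto_sqrt_atTop.comp
          (hR.const_mul_atTop two_pos)).const_mul_atTop hab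
    have h := (tendsto_inv_atTop_zero.comp ((tendsto_pow_atTop two_ne_zero).comp hsq)).const_mul 3
    simpa [Function.comp_def] using h
  refine tendsto_of_tendsto_of_tendsto_of_le_of_le' tendsto_const_nhds hlim
    -- A real supremum over an empty class is 0, so the bounds also hold when no such `θ` exists.
    (Eventually.of_forall fun n => Real.iSup_nonneg fun θ => FNR_nonneg _ _ (h1 n)) ?_
  filter_upwards [hs.eventually_ge_atTop 16, hR.eventually_gt_atTop 0,
    (tendsto_ratio hυ hs hsn).eventually_ge_atTop 1,
    hR.eventually (eventually_exponent_ge hb1 Λ (Real.log (16 / c₁)))] with n hs16 hRn hratio hexp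
  refine Real.iSup_le (fun θ => ?_) (by positivity)
  obtain ⟨θ, -, hsig, hcard⟩ := θ
  have hs16' : (16 : ℝ) ≤ s n := by exact_mod_cast hs16
  have hs0 : (0 : ℝ) < s n := by linarith
  have hsn' : (s n : ℝ) ≤ n := by rwa [one_le_div hs0] at hratio
  have hn0 : (0 : ℝ) < n := hs0.trans_le hsn'
  set w := (s n : ℝ) / (16 * n) with hw
  have hw0 : 0 < w := by positivity
  have hw1 : w ≤ 1 / 2 := by
    rw [hw, div_le_div_iff₀ (by positivity) (by norm_num)]
    linarith
  set R := Real.log ((n : ℝ) / (s n : ℝ)) with hRdef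
  have hlarge : ∀ x : ℝ, b * √(2 * R) ≤ |x| →
      Real.exp (-x ^ 2 / 2) ≤ c₁ * w * Real.exp (-(Λ * |x|)) := by
    intro x hx
    -- `w = exp (-R) / 16`, which explains the constant `log (16 / c₁)` added to `R`.
    have h : c₁ * w = Real.exp (-(R + Real.log (16 / c₁))) := by
      rw [hRdef, ← Real.log_mul (by positivity) (by positivity), ← Real.log_inv,
        Real.exp_log (by positivity), hw]
      field_simp
    rw [h, ← Real.exp_add]
    exact Real.exp_le_exp.2 (by linarith [hexp x hx])
  refine FNR_le (T := b * √(2 * R)) (by omega) θ hcard (ψ n) (h0 n) (h1 n) (fun i hi => ?_) ?_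
  · refine gaussianReal_abs_lt_le (by positivity) (le_trans (le_of_eq ?_) (hsig i hi))
    ring
  · intro X hX i hi
    refine hψ n X i w hw0 (hγ.le_wHat_of_many_large X hs16' hsn' _ (fun j hj => ?_) hX)
      ((hlarge _ hi).trans ?_)
    · have h2 := (phi_le_exp (X j)).trans (hlarge _ (Finset.mem_filter.1 hj).2.2)
      have h3 : c₁ * w * Real.exp (-(Λ * |X j|)) ≤ w / 2 * g γ (X j) := by
        calc c₁ * w * Real.exp (-(Λ * |X j|)) ≤ c₀ / 2 * w * Real.exp (-(Λ * |X j|)) := by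
              gcongr
              exact min_le_right _ _
          _ = w / 2 * (c₀ * Real.exp (-(Λ * |X j|))) := by ring
          _ ≤ w / 2 * g γ (X j) := by
              gcongr
              exact hg _
      have h4 : 1 ≤ w / 2 * (g γ (X j) / phi (X j)) := by
        rw [← mul_div_assoc, one_le_div (phi_pos _)]
        exact h2.trans h3
      unfold beta
      linarith
    · gcongr
      exact min_le_left _ _

end SpikeSlab

theorem theorem4 (γ : ℝ → ℝ) (Λ κ : ℝ) (hκ : κ ∈ Set.Icc (1 : ℝ) 2)
    (hγ : SpikeSlab.IsSlabDensity γ Λ κ)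
    (a : ℝ) (ha : 1 < a) (υ : ℝ) (hυ : υ ∈ Set.Ioo (0 : ℝ) 1)
    (s : ℕ → ℕ) (hs : Tendsto s atTop atTop) (hsn : ∀ n : ℕ, (s n : ℝ) ≤ (n : ℝ) ^ υ)
    (t : ℝ) (ht : t ∈ Set.Ioo (0 : ℝ) 1) :
    (∀ n : ℕ, Measurable (SpikeSlab.phiL γ t : (Fin n → ℝ) → Fin n → ℝ) ∧
      Measurable (SpikeSlab.phiQ γ t : (Fin n → ℝ) → Fin n → ℝ)) ∧
    Tendsto (fun n : ℕ => ⨆ θ : SpikeSlab.strongClass n (s n) a,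
      SpikeSlab.FNR (θ : Fin n → ℝ) (SpikeSlab.phiL γ t)) atTop (𝓝 0) ∧
    Tendsto (fun n : ℕ => ⨆ θ : SpikeSlab.strongClass n (s n) a,
      SpikeSlab.FNR (θ : Fin n → ℝ) (SpikeSlab.phiQ γ t)) atTop (𝓝 0) := by
  obtain ⟨c, hc, hg, hG⟩ := hγ.exists_lower_bound
  have ht0 : 0 < t := ht.1
  have key : ∀ {x w d : ℝ}, 0 < w → c * Real.exp (-(Λ * |x|)) ≤ d →
      Real.exp (-x ^ 2 / 2) ≤ t * c * w * Real.exp (-(Λ * |x|)) →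
      Real.exp (-x ^ 2 / 2) ≤ t * w * d := by
    intro x w d hw hd h
    refine h.trans ?_
    calc t * c * w * Real.exp (-(Λ * |x|)) = t * w * (c * Real.exp (-(Λ * |x|))) := by ring
      _ ≤ t * w * d := by gcongr
  refine ⟨fun n => ⟨hγ.measurable_phiL t n, hγ.measurable_phiQ t n⟩, ?_, ?_⟩
  · refine SpikeSlab.tendsto_iSup_FNR hγ ha hυ.2 hs hsn (mul_pos ht0 hc)
      (fun n => SpikeSlab.phiL γ t) ?_ ?_ ?_
    · intro n X i
      unfold SpikeSlab.phiL
      split_ifs <;> simp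
    · intro n X i
      unfold SpikeSlab.phiL
      split_ifs <;> simp
    · intro n X i w hw0 hw h
      exact if_pos (SpikeSlab.posterior_le hw0 hw (hγ.wHat_mem X).1.2 (SpikeSlab.phi_pos _).le
        (hγ.g_pos _) ht0.le ((SpikeSlab.phi_le_exp _).trans (key hw0 (hg _) h)))
  · refine SpikeSlab.tendsto_iSup_FNR hγ ha hυ.2 hs hsn (mul_pos ht0 hc)
      (fun n => SpikeSlab.phiQ γ t) ?_ ?_ ?_
    · intro n X i
      unfold SpikeSlab.phiQ
      split_ifs <;> simp
    · intro n X i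
      unfold SpikeSlab.phiQ
      split_ifs <;> simp
    · intro n X i w hw0 hw h
      have hG0 : 0 < SpikeSlab.GBar γ |X i| :=
        (mul_pos hc (Real.exp_pos _)).trans_le (hG (X i))
      have hP := SpikeSlab.PhiBar_le_exp (abs_nonneg (X i))
      rw [sq_abs] at hP
      exact if_pos (SpikeSlab.posterior_le hw0 hw (hγ.wHat_mem X).1.2
        (SpikeSlab.PhiBar_nonneg _) hG0 ht0.le (hP.trans (key hw0 (hG _) h)))
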